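/- Let $\Gamma$ be a simplicial graph (simple and undirected, not necessarily finite), and let $W_\Gamma=\langle V(\Gamma)\mid a^2=1\ (a\in V(\Gamma)),\ ab=ba \text{ if } a,b \text{ are adjacent}\rangle$ be the right-angled Coxeter group (RACG) it defines. For $X\subseteq V(\Gamma)$, the full subgraph on $X$ is the induced subgraph on $X$, and the (standard) parabolic subgroup of $W_\Gamma$ defined by it is the subgroup generated by $X$. A clique twin of a graph $G$ is a collection of maximal cliques of $G$ such that every clique of $G$ is contained in one of them; $m_C(G)$ is the least cardinality of a clique twin of $G$. A vertex cut of a connected graph $G$ is a finite set $S$ of vertices such that $G\setminus S$ has at least two connected components and no proper subset of $S$ has this property. For a connected graph $G$, let $CC(G)$ be the minimum of $m_C(G[S])$ over all vertex cuts $S$ of $G$, where $G[S]$ is the full subgraph on $S$, and $CC(G)=0$ if $G$ has no vertex cut. For an arbitrary non-empty graph $G$, let $CC(G)$ be the minimum of $CC(E)$ over the connected components $E$ of $G$; the empty graph has $CC=0$. Finally $\dim_{CC}(\Gamma)=\sup\{CC(G)\mid G \text{ a full subgraph of }\Gamma\}$. A group is one-ended if it has a finite generating set whose Cayley graph has exactly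 one end. Then: (1) If $\dim_{CC}(\Gamma)\ge 2$, then $W_\Gamma$ contains a one-ended parabolic subgroup. (2) If $G$ is a full subgraph of $\Gamma$ with $CC(G)\ge 2$ such that no proper full subgraph of $G$ has $CC\geq 2$, then $G$ is a $k$-cycle for some $k\ge 4$. (3) If a full subgraph $G$ of $\Gamma$ is a $k$-cycle with $k\ge 4$, then its RACG $W_G$ is one-ended, and so is the parabolic subgroup of $W_\Gamma$ defined by $G$. -/

import Mathlib

namespace RACG

universe u

/-! ### Vertex cuts, clique twins and the clique-connected dimension -/

section CliqueConnected

variable {V : Type u}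

/-- `S` separates `G` if `G` minus the full subgraph on `S` has at least two connected
components. -/
def Separates (G : SimpleGraph V) (S : Set V) : Prop :=
  Nontrivial (G.induce Sᶜ).ConnectedComponent

/-- A vertex cut of `G`: a finite set of vertices that separates `G`, while no other subset of it
does. -/
def IsVertexCut (G : SimpleGraph V) (S : Set V) : Prop :=
  S.Finite ∧ Separates G S ∧ ∀ T : Set V, T ⊂ S → ¬ Separates G T

/-- A clique twin of `G`: a collection of maximal cliques such that every clique of `G` is
contained in a member of the collection. Cliques are given by their vertex sets. -/
def IsCliqueTwin (G : SimpleGraph V) (𝒞 : Set (Set V)) : Prop :=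
  (∀ C ∈ 𝒞, Maximal G.IsClique C) ∧ ∀ C : Set V, G.IsClique C → ∃ D ∈ 𝒞, C ⊆ D

/-- `m_C(G)`, the least cardinality of a clique twin of `G`. -/
noncomputable def mC (G : SimpleGraph V) : ℕ∞ :=
  sInf {n : ℕ∞ | ∃ 𝒞 : Set (Set V), IsCliqueTwin G 𝒞 ∧ n = 𝒞.encard}

open Classical in
/-- `CC(G)` for a connected graph `G`: the minimum of `m_C(FS(S))` over the vertex cuts `S` of `G`,
and `0` if `G` has no vertex cut. -/
noncomputable def connectedCC (G : SimpleGraph V) : ℕ∞ :=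
  if ∃ S : Set V, IsVertexCut G S then
    sInf {n : ℕ∞ | ∃ S : Set V, IsVertexCut G S ∧ n = mC (G.induce S)}
  else 0

open Classical in
/-- `CC(G)` for an arbitrary graph `G`: the minimum of `CC(E)` over the connected components `E` of
`G`. The empty graph, which has no component, gets the value `0`. -/
noncomputable def CC (G : SimpleGraph V) : ℕ∞ :=
  if Nonempty V then ⨅ E : G.ConnectedComponent, connectedCC (G.induce E.supp) else 0

/-- The clique-connected dimension of `G`: the supremum of `CC` over all full subgraphs of `G`. -/
noncomputable def dimCC (G : SimpleGraph V) : ℕ∞ :=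
  ⨆ X : Set V, CC (G.induce X)

end CliqueConnected

/-! ### Right-angled Coxeter groups and their parabolic subgroups -/

section Group

variable {V : Type u}

open Classical in
/-- The Coxeter matrix of the right-angled Coxeter group with defining graph `Γ`: distinct vertices
commute if they are adjacent, and satisfy no relation (encoded by `0`) if they are not. -/
noncomputable def coxeterMatrix (Γ : SimpleGraph V) : CoxeterMatrix V where
  M := Matrix.of fun a b => if a = b then 1 else if Γ.Adj a b then 2 else 0
  isSymm := by
    ext a b
    simp only [Matrix.transpose_apply, Matrix.of_apply, eq_comm, Γ.adj_comm]
  diagonal a := by simp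
  off_diagonal a b h := by
    simp only [Matrix.of_apply, if_neg h]
    split_ifs <;> decide

/-- The right-angled Coxeter group `W_Γ`. -/
abbrev W (Γ : SimpleGraph V) : Type u := (coxeterMatrix Γ).Group

/-- The (standard) parabolic subgroup of `W_Γ` defined by a set `X` of vertices: the subgroup
generated by `X`. -/
noncomputable def parabolic (Γ : SimpleGraph V) (X : Set V) : Subgroup (W Γ) :=
  Subgroup.closure ((coxeterMatrix Γ).simple '' X)

end Group

/-- A group is one-ended if it has a finite generating set whose Cayley graph has exactly one end.
An end of a graph is a compatible choice, for each finite set `K` of vertices, of a connected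
component of the complement of `K`. -/
def IsOneEnded (G : Type u) [Group G] : Prop :=
  ∃ S : Set G, S.Finite ∧ Subgroup.closure S = ⊤ ∧
    ∃! e, e ∈ (SimpleGraph.mulCayley S).componentComplFunctor.sections

end RACG

/-! Everything passes through induced cycles of length at least 4. The subgraph on a set has `mC` at
least 2 exactly when the set is not a clique, so `CC ≥ 2` gives a vertex cut containing two
non-adjacent vertices a, b. Minimality of the cut makes every component of its complement touch both
a and b, so shortest paths from a to b through two different components close up to an induced cycle
(`exists_cycle_of_isVertexCut`). Conversely, a cycle of length at least 4 has vertex cuts but no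
separating clique, hence `CC ≥ 2`; so a minimal full subgraph with `CC ≥ 2` equals the cycle it
contains.

One-endedness comes from `isOneEnded_of_not_separates`, a Morse argument with word length on the
Cayley graph. The descents of w form a clique, so the non-descents span a connected graph, and each
edge d, d' in it gives a path wd, wdd', wd' above w. A walk can thus be pushed off its lowest
vertices, superlevel sets of the length are connected, and there is one end. Length and descents are
read off from pilings, a normal form obtained by letting the group act on stacks of blocks. A
retraction identifies a parabolic subgroup with the Coxeter group of its full subgraph. -/

namespace RACG

universe u v

/-! ### A criterion for one-endedness -/

section Ends

open SimpleGraph Relation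

variable {α : Type u}

/-- Adjacency inside the superlevel set `{f ≥ n}`. -/
def SuperlevelAdj (G : SimpleGraph α) (f : α → ℕ) (n : ℕ) (x y : α) : Prop :=
  G.Adj x y ∧ n ≤ f x ∧ n ≤ f y

/-- A vertex of height n on a walk in the superlevel set n is a local minimum, and `hup` replaces it
by a detour between its two upper neighbours. The second conjunct is the induction hypothesis needed
while the walk sits at such a vertex. -/
theorem superlevel_connected_succ {G : SimpleGraph α} {f : α → ℕ}
    (hstep : ∀ x y, G.Adj x y → f y = f x + 1 ∨ f x = f y + 1)
    (hup : ∀ w x y, G.Adj w x → G.Adj w y → f x = f w + 1 → f y = f w + 1 →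
      ReflTransGen (SuperlevelAdj G f (f w + 1)) x y) {n : ℕ} {x y : α}
    (hxy : ReflTransGen (SuperlevelAdj G f n) x y) (hx : n + 1 ≤ f x) :
    (n + 1 ≤ f y → ReflTransGen (SuperlevelAdj G f (n + 1)) x y) ∧
    (f y = n → ∀ z, G.Adj y z → f z = n + 1 → ReflTransGen (SuperlevelAdj G f (n + 1)) x z) := by
  induction hxy with
  | refl => exact ⟨fun _ => .refl, fun h => by omega⟩
  | @tail b c _ hbc ih =>
    obtain ⟨hadj, hb, hc⟩ := hbc
    rcases hstep b c hadj with h | h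
    · refine ⟨fun hc' => ?_, fun h' => by omega⟩
      rcases Nat.lt_or_ge n (f b) with hb' | hb'
      · exact (ih.1 hb').tail ⟨hadj, hb', hc'⟩
      · exact ih.2 (by omega) c hadj (by omega)
    · refine ⟨fun hc' => (ih.1 (by omega)).tail ⟨hadj, by omega, hc'⟩, fun hc' z hz hfz => ?_⟩
      refine (ih.1 (by omega)).trans ?_
      have := hup c b z hadj.symm hz (by omega) (by omega)
      rwa [hc'] at this

theorem superlevel_connected {G : SimpleGraph α} {f : α → ℕ} (hG : G.Preconnected)
    (hstep : ∀ x y, G.Adj x y → f y = f x + 1 ∨ f x = f y + 1)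
    (hup : ∀ w x y, G.Adj w x → G.Adj w y → f x = f w + 1 → f y = f w + 1 →
      ReflTransGen (SuperlevelAdj G f (f w + 1)) x y) (n : ℕ) :
    ∀ x y, n ≤ f x → n ≤ f y → ReflTransGen (SuperlevelAdj G f n) x y := by
  induction n with
  | zero =>
    intro x y _ _
    have hle : G.Adj ≤ SuperlevelAdj G f 0 := fun _ _ h => ⟨h, Nat.zero_le _, Nat.zero_le _⟩
    exact ReflTransGen.mono hle _ _ ((reachable_iff_reflTransGen x y).1 (hG x y))
  | succ n ih =>
    intro x y hx hy
    exact (superlevel_connected_succ hstep hup (ih x y (by omega) (by omega)) hx).1 hy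

/-- A graph with a proper unbounded function to `ℕ` whose superlevel sets are connected has exactly
one end. -/
theorem existsUnique_end {G : SimpleGraph α} {f : α → ℕ}
    (hconn : ∀ n x y, n ≤ f x → n ≤ f y → ReflTransGen (SuperlevelAdj G f n) x y)
    (hfin : ∀ n, {x | f x ≤ n}.Finite) (hunb : ∀ n, ∃ x, n ≤ f x) :
    ∃! e, e ∈ G.componentComplFunctor.sections := by
  classical
  have hout : ∀ (K : Finset α) (x : α), K.sup f + 1 ≤ f x → x ∉ (K : Set α) := by
    intro K x hx hK
    have := Finset.le_sup (f := f) (Finset.mem_coe.1 hK)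
    omega
  have key : ∀ (K : Finset α) (x y : α) (hx : K.sup f + 1 ≤ f x) (hy : K.sup f + 1 ≤ f y),
      G.componentComplMk (hout K x hx) = G.componentComplMk (hout K y hy) := by
    intro K x y hx hy
    have h := hconn _ x y hx hy
    induction h with
    | refl => rfl
    | @tail b c _ hbc ih =>
      rw [ih hbc.2.1]
      exact G.componentComplMk_eq_of_adj _ _ hbc.1
  choose v hv using fun K : Finset α => hunb (K.sup f + 1)
  refine ⟨fun K => G.componentComplMk (hout K.unop _ (hv K.unop)), ?_, ?_⟩
  · intro K L h
    have hLK : L.unop ⊆ K.unop := CategoryTheory.le_of_op_hom h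
    have : L.unop.sup f ≤ K.unop.sup f := Finset.sup_mono hLK
    have hvK := hv K.unop
    exact key L.unop (v K.unop) (v L.unop) (by omega) (hv _)
  · intro e he
    funext K
    -- Evaluating the end at a set containing the whole sublevel set forces its representative above
    -- the bound of `f` on K, where all vertices share one component.
    let L : Finset α := K.unop ∪ (hfin (K.unop.sup f)).toFinset
    obtain ⟨w, hw, hwe⟩ := (e (Opposite.op L) : G.ComponentCompl L).exists_eq_mk
    have hfw : K.unop.sup f + 1 ≤ f w := by
      by_contra hlt
      apply hw
      simp only [L, Finset.coe_union, Set.Finite.coe_toFinset, Set.mem_union]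
      exact Or.inr (by simp only [Set.mem_ofPred_eq]; omega)
    have hKL : K.unop ⊆ L := Finset.subset_union_left
    rw [end_hom_mk_of_mk G he (CategoryTheory.opHomOfLE (y := Opposite.op L) hKL) hw hwe.symm]
    exact key K.unop w (v K.unop) hfw (hv _)

end Ends

/-! ### Pilings: normal forms in right-angled Coxeter groups -/

section Pilings

open Classical Relation

variable {V : Type u} (Γ : SimpleGraph V)

theorem simple_mul_self (a : V) :
    (coxeterMatrix Γ).simple a * (coxeterMatrix Γ).simple a = 1 :=
  (coxeterMatrix Γ).toCoxeterSystem.simple_mul_simple_self a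

theorem mul_simple_mul_simple (w : W Γ) (a : V) :
    w * (coxeterMatrix Γ).simple a * (coxeterMatrix Γ).simple a = w := by
  rw [mul_assoc, simple_mul_self, mul_one]

theorem inv_simple (a : V) : ((coxeterMatrix Γ).simple a)⁻¹ = (coxeterMatrix Γ).simple a :=
  (coxeterMatrix Γ).toCoxeterSystem.inv_simple a

/-- A function on the vertices satisfies the relations of `W_Γ` as soon as its values are
involutions that commute for adjacent vertices. -/
theorem isLiftable_of_comm {M : Type*} [Monoid M] {f : V → M} (hf : ∀ a, f a * f a = 1)
    (hc : ∀ a b, Γ.Adj a b → f a * f b = f b * f a) : (coxeterMatrix Γ).IsLiftable f := by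
  intro a b
  by_cases hab : a = b
  · subst hab
    rw [hf, one_pow]
  · by_cases h : Γ.Adj a b
    · have hM : (coxeterMatrix Γ) a b = 2 := by
        change (if a = b then 1 else if Γ.Adj a b then 2 else 0) = 2
        rw [if_neg hab, if_pos h]
      rw [hM, pow_two, mul_assoc, ← mul_assoc (f b), ← hc a b h, mul_assoc, hf, mul_one, hf]
    · have hM : (coxeterMatrix Γ) a b = 0 := by
        change (if a = b then 1 else if Γ.Adj a b then 2 else 0) = 0
        rw [if_neg hab, if_neg h]
      rw [hM, pow_zero]

theorem simple_comm {a b : V} (h : Γ.Adj a b) :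
    (coxeterMatrix Γ).simple a * (coxeterMatrix Γ).simple b =
      (coxeterMatrix Γ).simple b * (coxeterMatrix Γ).simple a := by
  have h2 := (coxeterMatrix Γ).toCoxeterSystem.simple_mul_simple_pow a b
  have hM : (coxeterMatrix Γ) a b = 2 := by
    change (if a = b then 1 else if Γ.Adj a b then 2 else 0) = 2
    rw [if_neg h.ne, if_pos h]
  rw [hM, CoxeterMatrix.toCoxeterSystem_simple, pow_two] at h2
  have h3 := eq_inv_of_mul_eq_one_left h2
  rwa [mul_inv_rev, inv_simple, inv_simple] at h3

/-- The vertex `a` is the top of its own stack. -/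
def IsTop (p : V → List Bool) (a : V) : Prop := (p a).head? = some true

/-- Put a block of type `a` on a family of stacks: it is visible on the stack of `a`, and blocks the
stacks of the vertices not adjacent to `a`. -/
noncomputable def push (a : V) (p : V → List Bool) : V → List Bool :=
  fun b => if Γ.Adj a b then p b else decide (a = b) :: p b

/-- Remove a block of type `a`. -/
noncomputable def pop (a : V) (p : V → List Bool) : V → List Bool :=
  fun b => if Γ.Adj a b then p b else (p b).tail

variable {Γ} in
theorem push_adj {a b : V} (h : Γ.Adj a b) (p : V → List Bool) : push Γ a p b = p b := if_pos h

variable {Γ} in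
theorem pop_adj {a b : V} (h : Γ.Adj a b) (p : V → List Bool) : pop Γ a p b = p b := if_pos h

variable {Γ} in
theorem push_not_adj {a b : V} (h : ¬ Γ.Adj a b) (p : V → List Bool) :
    push Γ a p b = decide (a = b) :: p b := if_neg h

variable {Γ} in
theorem pop_not_adj {a b : V} (h : ¬ Γ.Adj a b) (p : V → List Bool) :
    pop Γ a p b = (p b).tail := if_neg h

theorem pop_push (a : V) (p : V → List Bool) : pop Γ a (push Γ a p) = p := by
  funext b
  by_cases h : Γ.Adj a b
  · rw [pop_adj h, push_adj h]
  · rw [pop_not_adj h, push_not_adj h, List.tail_cons]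

theorem isTop_push (a : V) (p : V → List Bool) : IsTop (push Γ a p) a := by
  rw [IsTop, push_not_adj (Γ.irrefl)]
  simp

variable {Γ} in
theorem isTop_push_of_ne {a b : V} (hab : a ≠ b) {p : V → List Bool} (h : IsTop (push Γ a p) b) :
    Γ.Adj a b ∧ IsTop p b := by
  by_cases hadj : Γ.Adj a b
  · exact ⟨hadj, by rwa [IsTop, push_adj hadj] at h⟩
  · rw [IsTop, push_not_adj hadj] at h
    simp [hab] at h

/-- `IsPiling Γ p w` says that `p` arises by piling up the letters of a reduced word for `w`. -/
inductive IsPiling : (V → List Bool) → W Γ → Prop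
  | empty : IsPiling (fun _ => []) 1
  | push {p : V → List Bool} {w : W Γ} (a : V) (hp : IsPiling p w) (ha : ¬ IsTop p a) :
      IsPiling (push Γ a p) (w * (coxeterMatrix Γ).simple a)

variable {Γ} in
-- The last block of type a left a blocker on the stack of b. Any later letter is adjacent to a, so
-- it is not b and can only add another blocker there.
theorem IsPiling.head_of_isTop {p : V → List Bool} {w : W Γ} (hp : IsPiling Γ p w) {a b : V}
    (ha : IsTop p a) (hab : a ≠ b) (hadj : ¬ Γ.Adj a b) : (p b).head? = some false := by
  induction hp with
  | empty => simp [IsTop] at ha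
  | @push p w c hp hc ih =>
    by_cases hca : c = a
    · subst hca
      rw [push_not_adj hadj]
      simp [hab]
    · obtain ⟨hca', ha'⟩ := isTop_push_of_ne hca ha
      by_cases hcb : Γ.Adj c b
      · rw [push_adj hcb]
        exact ih ha'
      · rw [push_not_adj hcb]
        have : c ≠ b := by
          rintro rfl
          exact hadj hca'.symm
        simp [this]

variable {Γ} in
-- The only delicate stacks are those of vertices b adjacent to neither a nor c. There both
-- operations act on blockers, and they commute because the stack already begins with `false`; this
-- fails for arbitrary families of stacks.
theorem push_pop_comm {a c : V} (hac : Γ.Adj c a) {p : V → List Bool} {w : W Γ}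
    (hp : IsPiling Γ p w) (ha : IsTop p a) :
    push Γ c (pop Γ a p) = pop Γ a (push Γ c p) := by
  funext b
  by_cases hab : Γ.Adj a b <;> by_cases hcb : Γ.Adj c b
  · rw [push_adj hcb, pop_adj hab, pop_adj hab, push_adj hcb]
  · rw [push_not_adj hcb, pop_adj hab, pop_adj hab, push_not_adj hcb]
  · rw [push_adj hcb, pop_not_adj hab, pop_not_adj hab, push_adj hcb]
  · have hne : a ≠ b := by
      rintro rfl
      exact hcb hac
    have hne' : c ≠ b := by
      rintro rfl
      exact hab hac.symm
    have h := hp.head_of_isTop ha hne hab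
    rw [push_not_adj hcb, pop_not_adj hab, pop_not_adj hab, push_not_adj hcb, List.tail_cons]
    obtain ⟨l, hl⟩ : ∃ l, p b = false :: l := by
      cases hpb : p b with
      | nil => simp [hpb] at h
      | cons x l => exact ⟨l, by simpa [hpb] using h⟩
    simp [hl, hne']

variable {Γ} in
-- If the last letter is a, undo it. Otherwise it is some c adjacent to a, and a was on top before c
-- was added: remove a first, then add c.
theorem IsPiling.pop {p : V → List Bool} {w : W Γ} (hp : IsPiling Γ p w) {a : V} (ha : IsTop p a) :
    IsPiling Γ (pop Γ a p) (w * (coxeterMatrix Γ).simple a) ∧ ¬ IsTop (RACG.pop Γ a p) a ∧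
      RACG.push Γ a (RACG.pop Γ a p) = p := by
  induction hp with
  | empty => simp [IsTop] at ha
  | @push p w c hp hc ih =>
    by_cases hca : c = a
    · subst hca
      rw [pop_push, mul_simple_mul_simple]
      exact ⟨hp, hc, rfl⟩
    · obtain ⟨hadj, ha'⟩ := isTop_push_of_ne hca ha
      obtain ⟨h1, h2, h3⟩ := ih ha'
      rw [← push_pop_comm hadj hp ha']
      refine ⟨?_, fun h => h2 (isTop_push_of_ne hca h).2, ?_⟩
      · rw [mul_assoc, simple_comm Γ hadj, ← mul_assoc]
        refine .push c h1 fun h => hc ?_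
        rwa [IsTop, pop_adj hadj.symm] at h
      · funext b
        have h3b := congrFun h3 b
        by_cases hab : Γ.Adj a b
        · rw [push_adj hab] at h3b ⊢
          by_cases hcb : Γ.Adj c b
          · rw [push_adj hcb, push_adj hcb, h3b]
          · rw [push_not_adj hcb, push_not_adj hcb, h3b]
        · rw [push_pop_comm hadj hp ha', push_not_adj hab, pop_not_adj hab]
          rw [push_not_adj hab, pop_not_adj hab] at h3b
          by_cases hcb : Γ.Adj c b
          · rw [push_adj hcb, h3b]
          · have hne : a ≠ b := by
              rintro rfl
              exact hcb hadj
            have hne' : c ≠ b := by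
              rintro rfl
              exact hab hadj.symm
            rw [push_not_adj hcb, List.tail_cons]
            simp [hne, hne']

/-- The action of a generator on families of stacks. -/
noncomputable def toggle (a : V) (p : V → List Bool) : V → List Bool :=
  if IsTop p a then pop Γ a p else push Γ a p

variable {Γ} in
theorem IsPiling.toggle {p : V → List Bool} {w : W Γ} (hp : IsPiling Γ p w) (a : V) :
    IsPiling Γ (toggle Γ a p) (w * (coxeterMatrix Γ).simple a) := by
  unfold RACG.toggle
  split_ifs with h
  · exact (hp.pop h).1
  · exact .push a hp h

variable {Γ} in
theorem IsPiling.toggle_toggle {p : V → List Bool} {w : W Γ} (hp : IsPiling Γ p w) (a : V) :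
    RACG.toggle Γ a (RACG.toggle Γ a p) = p := by
  by_cases h : IsTop p a
  · have h2 := hp.pop h
    rw [RACG.toggle, RACG.toggle, if_pos h, if_neg h2.2.1, h2.2.2]
  · rw [RACG.toggle, RACG.toggle, if_neg h, if_pos (isTop_push Γ a p), pop_push]

variable {Γ} in
theorem toggle_adj {a b : V} (h : Γ.Adj a b) (p : V → List Bool) : toggle Γ a p b = p b := by
  unfold toggle
  split_ifs
  · exact pop_adj h p
  · exact push_adj h p

variable {Γ} in
theorem isTop_toggle {a b : V} (h : Γ.Adj a b) (p : V → List Bool) :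
    IsTop (toggle Γ a p) b ↔ IsTop p b := by
  rw [IsTop, toggle_adj h, IsTop]

variable {Γ} in
-- Toggling one of two adjacent vertices leaves the stack of the other untouched, so both orders
-- make the same choices between push and pop; the mixed cases are `push_pop_comm`.
theorem IsPiling.toggle_comm {p : V → List Bool} {w : W Γ} (hp : IsPiling Γ p w) {a b : V}
    (h : Γ.Adj a b) :
    RACG.toggle Γ a (RACG.toggle Γ b p) = RACG.toggle Γ b (RACG.toggle Γ a p) := by
  have e1 : RACG.toggle Γ a (RACG.toggle Γ b p) =
      if IsTop p a then RACG.pop Γ a (RACG.toggle Γ b p)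
        else RACG.push Γ a (RACG.toggle Γ b p) := by
    rw [RACG.toggle]
    simp only [isTop_toggle h.symm]
  have e2 : RACG.toggle Γ b (RACG.toggle Γ a p) =
      if IsTop p b then RACG.pop Γ b (RACG.toggle Γ a p)
        else RACG.push Γ b (RACG.toggle Γ a p) := by
    rw [RACG.toggle]
    simp only [isTop_toggle h]
  rw [e1, e2, RACG.toggle, RACG.toggle]
  by_cases ha : IsTop p a <;> by_cases hb : IsTop p b
  · simp only [ha, hb, if_true]
    funext c
    unfold RACG.pop
    split_ifs <;> rfl
  · simp only [ha, hb, if_true, if_false]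
    exact (push_pop_comm h.symm hp ha).symm
  · simp only [ha, hb, if_true, if_false]
    exact push_pop_comm h hp hb
  · simp only [ha, hb, if_false]
    funext c
    by_cases hac : Γ.Adj a c <;> by_cases hbc : Γ.Adj b c
    · rw [push_adj hac, push_adj hbc, push_adj hbc, push_adj hac]
    · rw [push_adj hac, push_not_adj hbc, push_not_adj hbc, push_adj hac]
    · rw [push_not_adj hac, push_adj hbc, push_adj hbc, push_not_adj hac]
    · have hne : a ≠ c := by
        rintro rfl
        exact hbc h.symm
      have hne' : b ≠ c := by
        rintro rfl
        exact hac h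
      rw [push_not_adj hac, push_not_adj hbc, push_not_adj hbc, push_not_adj hac]
      simp [hne, hne']

/-- The pilings, each with an element that it represents. -/
abbrev PilingState : Type u := {x : (V → List Bool) × W Γ // IsPiling Γ x.1 x.2}

/-- The action of a generator on pilings. -/
noncomputable def toggleState (a : V) : Function.End (PilingState Γ) :=
  fun x => ⟨(toggle Γ a x.1.1, x.1.2 * (coxeterMatrix Γ).simple a), x.2.toggle a⟩

theorem isLiftable_toggleState : (coxeterMatrix Γ).IsLiftable (toggleState Γ) := by
  refine isLiftable_of_comm Γ (fun a => ?_) fun a b h => ?_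
  · funext x
    exact Subtype.ext (Prod.ext (x.2.toggle_toggle a) (mul_simple_mul_simple Γ _ a))
  · funext x
    refine Subtype.ext (Prod.ext (x.2.toggle_comm h) ?_)
    change x.1.2 * _ * _ = x.1.2 * _ * _
    rw [mul_assoc, mul_assoc, simple_comm Γ h]

/-- The action of `W_Γ` on pilings. -/
noncomputable def pilingAction : W Γ →* Function.End (PilingState Γ) :=
  (coxeterMatrix Γ).toCoxeterSystem.lift ⟨toggleState Γ, isLiftable_toggleState Γ⟩

theorem pilingAction_simple (a : V) :
    pilingAction Γ ((coxeterMatrix Γ).simple a) = toggleState Γ a :=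
  (coxeterMatrix Γ).toCoxeterSystem.lift_apply_simple (isLiftable_toggleState Γ) a

/-- The piling of an element of `W_Γ`. -/
noncomputable def piling (w : W Γ) : PilingState Γ :=
  -- The inverse converts the left action into right multiplication: appending a letter to w applies
  -- its toggle last.
  pilingAction Γ w⁻¹ ⟨(fun _ => [], 1), .empty⟩

theorem piling_mul_simple (w : W Γ) (a : V) :
    piling Γ (w * (coxeterMatrix Γ).simple a) = toggleState Γ a (piling Γ w) := by
  rw [piling, mul_inv_rev, inv_simple, map_mul, pilingAction_simple]
  rfl

theorem piling_snd (w : W Γ) : (piling Γ w).1.2 = w := by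
  induction w using (coxeterMatrix Γ).toCoxeterSystem.simple_induction_right with
  | one =>
    rw [piling, inv_one, map_one]
    rfl
  | mul_simple_right w a ih =>
    rw [CoxeterMatrix.toCoxeterSystem_simple, piling_mul_simple]
    change (piling Γ w).1.2 * _ = _
    rw [ih]

theorem isPiling_piling (w : W Γ) : IsPiling Γ (piling Γ w).1.1 w := by
  have := (piling Γ w).2
  rwa [piling_snd] at this

/-- The (right) descent set of `w`. -/
def descents (w : W Γ) : Set V := {a | IsTop (piling Γ w).1.1 a}

/-- Of two distinct non-adjacent vertices, one being on top puts a blocker on the stack of the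
other. -/
theorem isClique_descents (w : W Γ) : Γ.IsClique (descents Γ w) := by
  intro a ha b hb hab
  by_contra h
  have h1 := (isPiling_piling Γ w).head_of_isTop ha hab h
  have h2 : ((piling Γ w).1.1 b).head? = some true := hb
  rw [h1] at h2
  simp at h2

variable {Γ} in
theorem mem_descents_mul_simple_of_adj {a b : V} (h : Γ.Adj a b) (w : W Γ) :
    b ∈ descents Γ (w * (coxeterMatrix Γ).simple a) ↔ b ∈ descents Γ w := by
  change IsTop (piling Γ _).1.1 b ↔ IsTop (piling Γ w).1.1 b
  rw [piling_mul_simple]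
  exact isTop_toggle h _

/-! ### Length and finiteness of balls -/

variable [Fintype V]

/-- The number of visible blocks. -/
noncomputable def stackSize (p : V → List Bool) : ℕ := ∑ b, (p b).count true

theorem stackSize_push (a : V) (p : V → List Bool) :
    stackSize (push Γ a p) = stackSize p + 1 := by
  have h : ∀ b, (push Γ a p b).count true = (p b).count true + if a = b then 1 else 0 := by
    intro b
    by_cases hab : Γ.Adj a b
    · rw [push_adj hab, if_neg hab.ne, add_zero]
    · rw [push_not_adj hab, List.count_cons]
      simp
  simp only [stackSize, h, Finset.sum_add_distrib]
  simp

/-- The length of `w`. -/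
noncomputable def height (w : W Γ) : ℕ := stackSize (piling Γ w).1.1

theorem height_mul_of_notMem {w : W Γ} {a : V} (h : a ∉ descents Γ w) :
    height Γ (w * (coxeterMatrix Γ).simple a) = height Γ w + 1 := by
  rw [height, piling_mul_simple]
  change stackSize (toggle Γ a (piling Γ w).1.1) = _
  have h' : ¬ IsTop (piling Γ w).1.1 a := h
  rw [toggle, if_neg h', stackSize_push]
  rfl

theorem height_mul_of_mem {w : W Γ} {a : V} (h : a ∈ descents Γ w) :
    height Γ w = height Γ (w * (coxeterMatrix Γ).simple a) + 1 := by
  rw [height, height, piling_mul_simple]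
  change _ = stackSize (toggle Γ a (piling Γ w).1.1) + 1
  have h' : IsTop (piling Γ w).1.1 a := h
  rw [toggle, if_pos h', ← stackSize_push Γ a, ((piling Γ w).2.pop h').2.2]

/-- Stripping the last letter lowers the size by one, and there are finitely many letters. Allowing
any piling of w avoids having to prove uniqueness. -/
theorem finite_setOf_isPiling (n : ℕ) : {w : W Γ | ∃ p, IsPiling Γ p w ∧ stackSize p ≤ n}.Finite := by
  induction n with
  | zero =>
    refine (Set.finite_singleton 1).subset ?_
    rintro w ⟨p, hp, h⟩
    cases hp with
    | empty => rfl
    | push a hp ha =>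
      rw [stackSize_push] at h
      omega
  | succ n ih =>
    refine ((Set.finite_singleton 1).union (Set.Finite.image2
      (fun w a => w * (coxeterMatrix Γ).simple a) ih Set.finite_univ)).subset ?_
    rintro w ⟨p, hp, h⟩
    cases hp with
    | empty => exact Or.inl rfl
    | @push p w a hp ha =>
      rw [stackSize_push] at h
      exact Or.inr ⟨w, ⟨p, hp, by omega⟩, a, Set.mem_univ _, rfl⟩

theorem finite_height_le (n : ℕ) : {w : W Γ | height Γ w ≤ n}.Finite :=
  (finite_setOf_isPiling Γ n).subset fun w hw => ⟨_, isPiling_piling Γ w, hw⟩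

end Pilings

/-! ### Groups without separating cliques are one-ended -/

section OneEnded

open SimpleGraph Relation

variable {V : Type u}

theorem preconnected_of_not_separates {G : SimpleGraph V} {S : Set V} (h : ¬ Separates G S) :
    (G.induce Sᶜ).Preconnected := by
  have := not_nontrivial_iff_subsingleton.1 h
  exact fun x y => ConnectedComponent.exact (Subsingleton.elim _ _)

theorem mulCayley_range_adj (Γ : SimpleGraph V) [Fintype V] {H : Type v} [Group H] (e : W Γ ≃* H)
    (x y : H) : (mulCayley (Set.range fun a => e ((coxeterMatrix Γ).simple a))).Adj x y ↔
      ∃ a, y = x * e ((coxeterMatrix Γ).simple a) := by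
  rw [mulCayley_adj']
  constructor
  · rintro ⟨-, _, ⟨a, rfl⟩, h | h⟩
    · exact ⟨a, h.symm⟩
    · refine ⟨a, ?_⟩
      rw [h, mul_assoc, ← map_mul, simple_mul_self, map_one, mul_one]
  · rintro ⟨a, rfl⟩
    refine ⟨fun h => ?_, _, ⟨a, rfl⟩, Or.inl rfl⟩
    -- The Cayley graph has no loops, so generators must be nontrivial: multiplying by one changes
    -- the height.
    have h1 : e ((coxeterMatrix Γ).simple a) = 1 := (mul_eq_left.1 h.symm)
    rw [EmbeddingLike.map_eq_one_iff] at h1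
    by_cases ha : a ∈ descents Γ 1
    · have := height_mul_of_mem Γ ha
      rw [h1, mul_one] at this
      omega
    · have := height_mul_of_notMem Γ ha
      rw [h1, mul_one] at this
      omega

theorem height_mul_cases (Γ : SimpleGraph V) [Fintype V] (w : W Γ) (a : V) :
    height Γ (w * (coxeterMatrix Γ).simple a) = height Γ w + 1 ∨
      height Γ w = height Γ (w * (coxeterMatrix Γ).simple a) + 1 := by
  by_cases ha : a ∈ descents Γ w
  · exact Or.inr (height_mul_of_mem Γ ha)
  · exact Or.inl (height_mul_of_notMem Γ ha)

theorem notMem_descents_of_height (Γ : SimpleGraph V) [Fintype V] {w : W Γ} {a : V}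
    (h : height Γ (w * (coxeterMatrix Γ).simple a) = height Γ w + 1) : a ∉ descents Γ w := by
  intro ha
  have := height_mul_of_mem Γ ha
  omega

/-- The right-angled Coxeter group of a finite graph that is not complete and has no separating
clique is one-ended. -/
theorem isOneEnded_of_not_separates (Γ : SimpleGraph V) [Fintype V]
    (hΓ : ¬ Γ.IsClique Set.univ) (hsep : ∀ D : Set V, Γ.IsClique D → ¬ Separates Γ D)
    {H : Type v} [Group H] (e : W Γ ≃* H) : IsOneEnded H := by
  refine ⟨Set.range fun a => e ((coxeterMatrix Γ).simple a), Set.finite_range _, ?_, ?_⟩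
  · have h := (coxeterMatrix Γ).toCoxeterSystem.subgroup_closure_range_simple
    rw [CoxeterMatrix.toCoxeterSystem_simple] at h
    have h2 : (Set.range fun a => e ((coxeterMatrix Γ).simple a)) =
        e.toMonoidHom '' Set.range (coxeterMatrix Γ).simple := by
      rw [← Set.range_comp]
      rfl
    rw [h2, ← MonoidHom.map_closure, h, ← MonoidHom.range_eq_map]
    exact MonoidHom.range_eq_top.2 e.surjective
  · let f : H → ℕ := fun x => height Γ (e.symm x)
    have hf : ∀ x a, e.symm (x * e ((coxeterMatrix Γ).simple a)) =
        e.symm x * (coxeterMatrix Γ).simple a := fun x a => by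
      rw [map_mul, e.symm_apply_apply]
    refine existsUnique_end (f := f) (superlevel_connected ?_ ?_ ?_) ?_ ?_
    · have h1 : ∀ w : W Γ, (mulCayley (Set.range fun a => e ((coxeterMatrix Γ).simple a))).Reachable
          1 (e w) := by
        intro w
        induction w using (coxeterMatrix Γ).toCoxeterSystem.simple_induction_right with
        | one => rw [map_one]
        | mul_simple_right w a ih =>
          refine ih.trans (Adj.reachable ((mulCayley_range_adj Γ e _ _).2 ⟨a, ?_⟩))
          rw [map_mul, CoxeterMatrix.toCoxeterSystem_simple]
      intro x y
      have hx := h1 (e.symm x)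
      have hy := h1 (e.symm y)
      rw [e.apply_symm_apply] at hx hy
      exact hx.symm.trans hy
    · intro x y hxy
      obtain ⟨a, rfl⟩ := (mulCayley_range_adj Γ e _ _).1 hxy
      simp only [f, hf]
      exact height_mul_cases Γ _ a
    · intro w x y hx hy hfx hfy
      obtain ⟨a, rfl⟩ := (mulCayley_range_adj Γ e _ _).1 hx
      obtain ⟨b, rfl⟩ := (mulCayley_range_adj Γ e _ _).1 hy
      simp only [f, hf] at hfx hfy
      have ha := notMem_descents_of_height Γ hfx
      have hb := notMem_descents_of_height Γ hfy
      -- The descents of w form a clique, so the ascents a and b are joined by a walk of ascents in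
      -- Γ.
      have hab := preconnected_of_not_separates (hsep _ (isClique_descents Γ (e.symm w)))
        ⟨a, ha⟩ ⟨b, hb⟩
      rw [reachable_iff_reflTransGen] at hab
      suffices h : ∀ c d : ((descents Γ (e.symm w))ᶜ : Set V),
          ReflTransGen (Γ.induce (descents Γ (e.symm w))ᶜ).Adj c d →
          ReflTransGen (SuperlevelAdj _ f (f w + 1)) (w * e ((coxeterMatrix Γ).simple c))
            (w * e ((coxeterMatrix Γ).simple d)) from h _ _ hab
      intro c d hcd
      induction hcd with
      | refl => exact .refl
      | @tail d d' _ hadj ih =>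
        have hadj' : Γ.Adj d d' := hadj
        have h1 : f (w * e ((coxeterMatrix Γ).simple d)) = f w + 1 := by
          simp only [f, hf]
          exact height_mul_of_notMem Γ d.2
        have h2 : f (w * e ((coxeterMatrix Γ).simple d')) = f w + 1 := by
          simp only [f, hf]
          exact height_mul_of_notMem Γ d'.2
        -- The top corner of the square spanned by the commuting generators d, d' lies two levels
        -- above w.
        have h3 : f (w * e ((coxeterMatrix Γ).simple d) * e ((coxeterMatrix Γ).simple d')) =
            f w + 1 + 1 := by
          have := height_mul_of_notMem Γ
            (mt (mem_descents_mul_simple_of_adj hadj' (e.symm w)).1 d'.2)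
          rw [height_mul_of_notMem Γ d.2] at this
          simpa only [f, hf] using this
        refine (ih.tail ⟨(mulCayley_range_adj Γ e _ _).2 ⟨d', rfl⟩, h1.ge, by omega⟩).tail
          ⟨(mulCayley_range_adj Γ e _ _).2 ⟨d, ?_⟩, by omega, h2.ge⟩
        simp only [mul_assoc, ← map_mul]
        rw [simple_comm Γ hadj'.symm, ← mul_assoc (((coxeterMatrix Γ).simple d)), simple_mul_self,
          one_mul]
    · intro n
      exact (finite_height_le Γ n).preimage e.symm.injective.injOn
    · intro n
      induction n with
      | zero => exact ⟨1, Nat.zero_le _⟩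
      | succ n ih =>
        obtain ⟨x, hx⟩ := ih
        -- Since Γ is not complete, the clique of descents misses a vertex, so the length can always
        -- be increased.
        have : ∃ a, a ∉ descents Γ (e.symm x) := by
          by_contra! h
          exact hΓ (by rw [← Set.eq_univ_of_forall h]; exact isClique_descents Γ _)
        obtain ⟨a, ha⟩ := this
        refine ⟨x * e ((coxeterMatrix Γ).simple a), ?_⟩
        simp only [f, hf, height_mul_of_notMem Γ ha]
        simp only [f] at hx
        omega

/-! ### Parabolic subgroups -/

open Classical in
/-- The retraction of `W_Γ` onto the group of a full subgraph, on the generators. -/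
noncomputable def retractionFun (Γ : SimpleGraph V) (X : Set V) (a : V) : W (Γ.induce X) :=
  if h : a ∈ X then (coxeterMatrix (Γ.induce X)).simple ⟨a, h⟩ else 1

theorem isLiftable_retractionFun (Γ : SimpleGraph V) (X : Set V) :
    (coxeterMatrix Γ).IsLiftable (retractionFun Γ X) := by
  unfold retractionFun
  refine isLiftable_of_comm Γ (fun a => ?_) fun a b h => ?_
  · split_ifs
    · exact simple_mul_self _ _
    · exact mul_one 1
  · split_ifs with ha hb hb
    · have hadj : (Γ.induce X).Adj ⟨a, ha⟩ ⟨b, hb⟩ := h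
      exact simple_comm _ hadj
    · rw [mul_one, one_mul]
    · rw [mul_one, one_mul]
    · rfl

/-- The retraction of `W_Γ` onto the group of a full subgraph. -/
noncomputable def retraction (Γ : SimpleGraph V) (X : Set V) : W Γ →* W (Γ.induce X) :=
  (coxeterMatrix Γ).toCoxeterSystem.lift ⟨retractionFun Γ X, isLiftable_retractionFun Γ X⟩

theorem isLiftable_simple_coe (Γ : SimpleGraph V) (X : Set V) :
    (coxeterMatrix (Γ.induce X)).IsLiftable fun a : X => (coxeterMatrix Γ).simple (a : V) :=
  isLiftable_of_comm _ (fun a => simple_mul_self Γ a) fun _ _ h => simple_comm Γ h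

/-- The homomorphism from the group of a full subgraph to `W_Γ`. -/
noncomputable def inclusion (Γ : SimpleGraph V) (X : Set V) : W (Γ.induce X) →* W Γ :=
  (coxeterMatrix (Γ.induce X)).toCoxeterSystem.lift
    ⟨fun a => (coxeterMatrix Γ).simple a, isLiftable_simple_coe Γ X⟩

theorem inclusion_simple (Γ : SimpleGraph V) (X : Set V) (a : X) :
    inclusion Γ X ((coxeterMatrix (Γ.induce X)).simple a) = (coxeterMatrix Γ).simple a :=
  (coxeterMatrix (Γ.induce X)).toCoxeterSystem.lift_apply_simple (isLiftable_simple_coe Γ X) a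

theorem retraction_simple (Γ : SimpleGraph V) (X : Set V) (a : X) :
    retraction Γ X ((coxeterMatrix Γ).simple a) = (coxeterMatrix (Γ.induce X)).simple a :=
  ((coxeterMatrix Γ).toCoxeterSystem.lift_apply_simple (isLiftable_retractionFun Γ X)
    (a : V)).trans (dif_pos a.2)

/-- Killing the generators outside X gives a left inverse. -/
theorem inclusion_injective (Γ : SimpleGraph V) (X : Set V) :
    Function.Injective (inclusion Γ X) := by
  have h : (retraction Γ X).comp (inclusion Γ X) = MonoidHom.id _ := by
    refine (coxeterMatrix (Γ.induce X)).toCoxeterSystem.ext_simple fun a => ?_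
    rw [CoxeterMatrix.toCoxeterSystem_simple, MonoidHom.comp_apply, inclusion_simple,
      retraction_simple, MonoidHom.id_apply]
  exact Function.LeftInverse.injective (g := retraction Γ X) fun x => DFunLike.congr_fun h x

theorem range_inclusion (Γ : SimpleGraph V) (X : Set V) :
    (inclusion Γ X).range = parabolic Γ X := by
  have h := (coxeterMatrix (Γ.induce X)).toCoxeterSystem.subgroup_closure_range_simple
  rw [MonoidHom.range_eq_map, ← h, MonoidHom.map_closure, parabolic, ← Set.range_comp]
  congr 1
  ext w
  constructor
  · rintro ⟨a, rfl⟩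
    exact ⟨a, a.2, (inclusion_simple Γ X a).symm⟩
  · rintro ⟨a, ha, rfl⟩
    exact ⟨⟨a, ha⟩, inclusion_simple Γ X ⟨a, ha⟩⟩

/-- The parabolic subgroup defined by `X` is the right-angled Coxeter group of the full subgraph on
`X`. -/
noncomputable def parabolicEquiv (Γ : SimpleGraph V) (X : Set V) :
    W (Γ.induce X) ≃* parabolic Γ X :=
  (MonoidHom.ofInjective (inclusion_injective Γ X)).trans
    (MulEquiv.subgroupCongr (range_inclusion Γ X))

end OneEnded

/-! ### Cycles -/

section Cycles

open SimpleGraph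
open scoped Fin.CommRing Fin.NatCast

variable {V : Type u}

theorem natCast_fin_ne {n i j : ℕ} (hi : i < n + 4) (hj : j < n + 4) (hij : i ≠ j) :
    (i : Fin (n + 4)) ≠ (j : Fin (n + 4)) := by
  intro h
  have := congrArg Fin.val h
  rw [Fin.val_natCast, Fin.val_natCast, Nat.mod_eq_of_lt hi, Nat.mod_eq_of_lt hj] at this
  exact hij this

/-- The two neighbours of a vertex x differ by 2, which is not ±1 modulo a number that is at least
4, so a clique containing x contains at most one of them. -/
theorem cycle_clique_subset {n : ℕ} {D : Set (Fin (n + 4))} (hD : (cycleGraph (n + 4)).IsClique D) :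
    ∃ i, D ⊆ {i, i + 1} := by
  by_cases hne : D.Nonempty
  · obtain ⟨x, hx⟩ := hne
    have hnear : ∀ z ∈ D, z = x ∨ z = x - 1 ∨ z = x + 1 := by
      intro z hz
      by_cases hzx : z = x
      · exact Or.inl hzx
      · rcases hD hz hx hzx with h | h
        · exact Or.inr (Or.inr (by rw [← h]; abel))
        · exact Or.inr (Or.inl (by rw [← h]; abel))
    by_cases hy : x - 1 ∈ D
    · refine ⟨x - 1, fun z hz => ?_⟩
      rcases hnear z hz with rfl | rfl | rfl
      · exact Or.inr (by simp)
      · exact Or.inl rfl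
      · exfalso
        have h2 : (x + 1) - (x - 1) = 2 := by ring
        have h3 : (x - 1) - (x + 1) = -2 := by ring
        have h21 : (2 : Fin (n + 4)) ≠ 1 := by
          exact_mod_cast natCast_fin_ne (n := n) (i := 2) (j := 1) (by omega) (by omega) (by omega)
        have h22 : (2 : Fin (n + 4)) ≠ 0 := by
          exact_mod_cast natCast_fin_ne (n := n) (i := 2) (j := 0) (by omega) (by omega) (by omega)
        have h30 : (3 : Fin (n + 4)) ≠ 0 := by
          exact_mod_cast natCast_fin_ne (n := n) (i := 3) (j := 0) (by omega) (by omega) (by omega)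
        have h31 : (-2 : Fin (n + 4)) ≠ 1 := by
          intro h
          have h5 : (3 : Fin (n + 4)) = 1 - (-2) := by ring
          exact h30 (by rw [h5, h, sub_self])
        rcases hD hz hy (fun h => h22 (by rw [← h2, h, sub_self])) with h | h
        · exact h21 (h2 ▸ h)
        · exact h31 (h3 ▸ h)
    · refine ⟨x, fun z hz => ?_⟩
      rcases hnear z hz with rfl | rfl | rfl
      · exact Or.inl rfl
      · exact absurd hz hy
      · exact Or.inr rfl
  · rw [Set.not_nonempty_iff_eq_empty] at hne
    exact ⟨0, by simp [hne]⟩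

/-- The path i+2, …, i+n+3 always survives. If i or i+1 survives as well, it is attached to the far
or the near end of this path. -/
theorem cycle_preconnected_compl {n : ℕ} {D : Set (Fin (n + 4))} {i : Fin (n + 4)}
    (hD : D ⊆ {i, i + 1}) : ((cycleGraph (n + 4)).induce Dᶜ).Preconnected := by
  have hmem : ∀ j : ℕ, j ≤ n + 1 → i + ((j + 2 : ℕ) : Fin (n + 4)) ∈ Dᶜ := by
    intro j hj h
    have hv : ((j + 2 : ℕ) : Fin (n + 4)).val = j + 2 := by
      rw [Fin.val_natCast, Nat.mod_eq_of_lt (by omega)]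
    rcases hD h with h | h
    · have h' := add_eq_left.1 h
      rw [h'] at hv
      simp at hv
    · have h' := add_left_cancel (Set.mem_singleton_iff.1 h)
      rw [h'] at hv
      simp at hv
  have hpath : ∀ (j : ℕ) (hj : j ≤ n + 1), ((cycleGraph (n + 4)).induce Dᶜ).Reachable
      ⟨_, hmem 0 (by omega)⟩ ⟨_, hmem j hj⟩ := by
    intro j hj
    induction j with
    | zero => exact .refl _
    | succ j ih =>
      refine (ih (by omega)).trans (Adj.reachable (Or.inr ?_))
      change (i + ((j + 1 + 2 : ℕ) : Fin (n + 4))) - (i + ((j + 2 : ℕ) : Fin (n + 4))) = 1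
      push_cast
      ring
  have hall : ∀ y : (Dᶜ : Set (Fin (n + 4))), ((cycleGraph (n + 4)).induce Dᶜ).Reachable
      ⟨_, hmem 0 (by omega)⟩ y := by
    rintro ⟨y, hy⟩
    obtain ⟨d, hd, hyd⟩ : ∃ d : ℕ, d < n + 4 ∧ y = i + (d : Fin (n + 4)) :=
      ⟨(y - i).val, (y - i).isLt, by rw [Fin.cast_val_eq_self]; ring⟩
    subst hyd
    rcases d with _ | _ | j
    · refine (hpath (n + 1) le_rfl).trans (Adj.reachable (Or.inr ?_))
      change (i + ((0 : ℕ) : Fin (n + 4))) - (i + ((n + 1 + 2 : ℕ) : Fin (n + 4))) = 1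
      have h0 : ((n + 4 : ℕ) : Fin (n + 4)) = 0 := Fin.natCast_self _
      have h1 : (i + ((0 : ℕ) : Fin (n + 4))) - (i + ((n + 1 + 2 : ℕ) : Fin (n + 4))) =
          1 - ((n + 4 : ℕ) : Fin (n + 4)) := by
        push_cast
        ring
      rw [h1, h0, sub_zero]
    · refine Adj.reachable (Or.inl ?_)
      change (i + ((0 + 2 : ℕ) : Fin (n + 4))) - (i + ((0 + 1 : ℕ) : Fin (n + 4))) = 1
      push_cast
      ring
    · exact hpath j (by omega)
  exact fun x y => (hall x).symm.trans (hall y)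

theorem not_separates_of_preconnected {G : SimpleGraph V} {S : Set V}
    (h : (G.induce Sᶜ).Preconnected) : ¬ Separates G S := by
  rw [Separates, not_nontrivial_iff_subsingleton]
  exact h.subsingleton_connectedComponent

variable {G : SimpleGraph V} {k : ℕ}

/-- No clique separates a cycle of length at least 4. -/
theorem cycle_not_separates (hk : 4 ≤ k) (φ : G ≃g cycleGraph k) {D : Set V} (hD : G.IsClique D) :
    ¬ Separates G D := by
  obtain ⟨n, rfl⟩ := Nat.exists_eq_add_of_le' hk
  have hD' : (cycleGraph (n + 4)).IsClique (φ '' D) := by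
    rintro _ ⟨x, hx, rfl⟩ _ ⟨y, hy, rfl⟩ hne
    exact φ.map_adj_iff.2 (hD hx hy fun h => hne (by rw [h]))
  obtain ⟨i, hi⟩ := cycle_clique_subset hD'
  apply not_separates_of_preconnected
  intro x y
  have hmaps : Set.MapsTo φ.symm (φ '' D)ᶜ Dᶜ := by
    intro z hz h
    exact hz ⟨_, h, φ.apply_symm_apply z⟩
  have hx : φ x ∈ (φ '' D)ᶜ := by
    rintro ⟨z, hz, h⟩
    exact x.2 (φ.injective h ▸ hz)
  have hy : φ y ∈ (φ '' D)ᶜ := by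
    rintro ⟨z, hz, h⟩
    exact y.2 (φ.injective h ▸ hz)
  have h := (cycle_preconnected_compl hi ⟨_, hx⟩ ⟨_, hy⟩).map (induceHom φ.symm.toHom hmaps)
  convert h using 1
  · exact Subtype.ext (φ.symm_apply_apply _).symm
  · exact Subtype.ext (φ.symm_apply_apply _).symm

/-- Deleting 0 and 2 isolates 1 from 3. A proper subset of the pair has at most one vertex, so it is
a clique and cannot separate. -/
theorem exists_isVertexCut_of_cycle (hk : 4 ≤ k) (φ : G ≃g cycleGraph k) :
    ∃ S, IsVertexCut G S := by
  obtain ⟨n, rfl⟩ := Nat.exists_eq_add_of_le' hk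
  refine ⟨φ.symm '' {0, 2}, Set.toFinite _, ?_, fun T hT => ?_⟩
  · have h1 : φ.symm 1 ∈ (φ.symm '' {0, 2})ᶜ := by
      rintro ⟨z, hz, h⟩
      have hz1 := φ.symm.injective h
      subst hz1
      rcases hz with h | h
      · exact natCast_fin_ne (n := n) (i := 1) (j := 0) (by omega) (by omega)
          (by omega) (by exact_mod_cast h)
      · exact natCast_fin_ne (n := n) (i := 1) (j := 2) (by omega) (by omega)
          (by omega) (by exact_mod_cast h)
    have h3 : φ.symm 3 ∈ (φ.symm '' {0, 2})ᶜ := by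
      rintro ⟨z, hz, h⟩
      have hz1 := φ.symm.injective h
      subst hz1
      rcases hz with h | h
      · exact natCast_fin_ne (n := n) (i := 3) (j := 0) (by omega) (by omega)
          (by omega) (by exact_mod_cast h)
      · exact natCast_fin_ne (n := n) (i := 3) (j := 2) (by omega) (by omega)
          (by omega) (by exact_mod_cast h)
    refine ⟨connectedComponentMk _ ⟨_, h1⟩, connectedComponentMk _ ⟨_, h3⟩, fun h => ?_⟩
    have hne : (⟨_, h1⟩ : ((φ.symm '' {0, 2})ᶜ : Set V)) ≠ ⟨_, h3⟩ := by
      intro h'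
      have h13 := φ.symm.injective (congrArg Subtype.val h')
      exact natCast_fin_ne (n := n) (i := 1) (j := 3) (by omega) (by omega) (by omega)
        (by exact_mod_cast h13)
    obtain ⟨z, hadj⟩ := (mem_support _).1
      (mem_support_of_reachable hne (ConnectedComponent.exact h))
    have hadj' : G.Adj (φ.symm 1) z := hadj
    rw [← φ.map_adj_iff, φ.apply_symm_apply] at hadj'
    apply z.2
    refine ⟨φ z, ?_, φ.symm_apply_apply _⟩
    rcases hadj' with h | h
    · refine Or.inl ?_
      rw [sub_eq_iff_eq_add] at h
      simpa using h
    · refine Or.inr ?_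
      rw [sub_eq_iff_eq_add] at h
      rw [h, Set.mem_singleton_iff]
      norm_num
  · apply cycle_not_separates hk φ
    apply Set.Subsingleton.pairwise
    obtain ⟨hsub, hnot⟩ := hT
    rw [Set.image_pair] at hsub hnot
    intro x hx y hy
    by_contra hxy
    apply hnot
    rintro z (rfl | rfl)
    · rcases hsub hx with h1 | h1 <;> rcases hsub hy with h2 | h2
      · exact absurd (h1.trans h2.symm) hxy
      · exact h1 ▸ hx
      · exact h2 ▸ hy
      · exact absurd (h1.trans h2.symm) hxy
    · rcases hsub hx with h1 | h1 <;> rcases hsub hy with h2 | h2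
      · exact absurd (h1.trans h2.symm) hxy
      · exact (Set.mem_singleton_iff.1 h2) ▸ hy
      · exact (Set.mem_singleton_iff.1 h1) ▸ hx
      · exact absurd (h1.trans h2.symm) hxy

/-! ### Clique twins -/

theorem mC_le_one_of_isClique {S : Set V} (hS : G.IsClique S) : mC (G.induce S) ≤ 1 := by
  refine sInf_le ⟨{Set.univ}, ⟨?_, fun C _ => ⟨_, rfl, Set.subset_univ C⟩⟩, ?_⟩
  · rintro _ rfl
    exact ⟨fun x _ y _ h => hS x.2 y.2 fun h' => h (Subtype.ext h'), fun _ _ _ => Set.subset_univ _⟩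
  · rw [Set.encard_singleton]

/-- A single member of a clique twin would have to contain every vertex, since singletons are
cliques. -/
theorem two_le_mC_of_not_isClique {S : Set V} (hS : ¬ G.IsClique S) : 2 ≤ mC (G.induce S) := by
  refine le_sInf ?_
  rintro _ ⟨𝒞, ⟨hmax, hcov⟩, rfl⟩
  by_contra hlt
  have hle : 𝒞.encard ≤ 1 := by
    rw [not_le] at hlt
    exact ENat.lt_add_one_iff (by simp) |>.1 (by rwa [one_add_one_eq_two])
  rw [Set.encard_le_one_iff] at hle
  apply hS
  intro x hx y hy hxy
  obtain ⟨D, hD, hxD⟩ := hcov {⟨x, hx⟩} (by simp)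
  obtain ⟨E, hE, hyE⟩ := hcov {⟨y, hy⟩} (by simp)
  obtain rfl := hle D E hD hE
  exact (hmax D hD).1 (hxD rfl) (hyE rfl) fun h => hxy (congrArg Subtype.val h)

theorem two_le_connectedCC_of_cycle (hk : 4 ≤ k) (φ : G ≃g cycleGraph k) : 2 ≤ connectedCC G := by
  rw [connectedCC, if_pos (exists_isVertexCut_of_cycle hk φ)]
  refine le_sInf ?_
  rintro _ ⟨S, hS, rfl⟩
  exact two_le_mC_of_not_isClique fun h => cycle_not_separates hk φ h hS.2.1

theorem two_le_CC_of_cycle (hk : 4 ≤ k) (φ : G ≃g cycleGraph k) : 2 ≤ CC G := by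
  have hV : Nonempty V := ⟨φ.symm ⟨0, by omega⟩⟩
  rw [CC, if_pos hV]
  refine le_iInf fun E => ?_
  have hconn : G.Preconnected := φ.preconnected_iff.2 cycleGraph_preconnected
  have hE : E.supp = Set.univ := by
    have := hconn.subsingleton_connectedComponent
    exact Set.eq_univ_of_forall fun v => Subsingleton.elim _ _
  rw [hE]
  exact two_le_connectedCC_of_cycle hk ((induceUnivIso G).trans φ)

theorem exists_isVertexCut_of_two_le_connectedCC (h : 2 ≤ connectedCC G) :
    ∃ S, IsVertexCut G S ∧ ¬ G.IsClique S := by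
  by_cases hex : ∃ S, IsVertexCut G S
  · rw [connectedCC, if_pos hex] at h
    obtain ⟨S, hS⟩ := hex
    refine ⟨S, hS, fun hcl => ?_⟩
    have h1 : (2 : ℕ∞) ≤ 1 :=
      (h.trans (sInf_le ⟨S, hS, rfl⟩)).trans (mC_le_one_of_isClique hcl)
    exact absurd h1 (by decide)
  · rw [connectedCC, if_neg hex] at h
    exact absurd h (by simp)

theorem exists_component_of_two_le_CC (h : 2 ≤ CC G) :
    ∃ E : G.ConnectedComponent, 2 ≤ connectedCC (G.induce E.supp) := by
  by_cases hV : Nonempty V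
  · rw [CC, if_pos hV] at h
    exact ⟨G.connectedComponentMk hV.some, h.trans (iInf_le _ _)⟩
  · rw [CC, if_neg hV] at h
    exact absurd h (by simp)

end Cycles

/-! ### Induced cycles through a cut that is not a clique -/

section InducedCycles

open SimpleGraph

variable {V : Type u} {G : SimpleGraph V}

theorem cycleGraph_adj_iff {k : ℕ} (hk : 2 ≤ k) (x y : Fin k) :
    (cycleGraph k).Adj x y ↔ x.val + 1 = y.val ∨ y.val + 1 = x.val ∨
      (x.val = 0 ∧ y.val + 1 = k) ∨ (y.val = 0 ∧ x.val + 1 = k) := by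
  have h : ∀ a b : Fin k, (a - b).val = 1 ↔ b.val + 1 = a.val ∨ (a.val = 0 ∧ b.val + 1 = k) := by
    intro a b
    have ha := a.isLt
    have hb := b.isLt
    rw [Fin.val_sub]
    rcases Nat.lt_or_ge a.val b.val with hab | hab
    · rw [Nat.mod_eq_of_lt (by omega)]
      omega
    · rw [Nat.mod_eq_sub_mod (by omega), Nat.mod_eq_of_lt (by omega)]
      omega
  rw [cycleGraph_adj', h, h]
  tauto

/-- `p 0, …, p n` are the vertices of an induced path. -/
structure IsInducedPath (G : SimpleGraph V) (n : ℕ) (p : ℕ → V) : Prop where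
  inj : ∀ i j, i ≤ n → j ≤ n → p i = p j → i = j
  adj_iff : ∀ i j, i ≤ n → j ≤ n → (G.Adj (p i) (p j) ↔ i + 1 = j ∨ j + 1 = i)

theorem exists_isInducedPath {U : Set V} {a b : V} (ha : a ∈ U) (hb : b ∈ U)
    (h : (G.induce U).Reachable ⟨a, ha⟩ ⟨b, hb⟩) :
    ∃ n p, IsInducedPath G n p ∧ p 0 = a ∧ p n = b ∧ ∀ i, p i ∈ U := by
  obtain ⟨w, hw⟩ := h.exists_walk_length_eq_dist
  have hd : ∀ i, i ≤ w.length → (G.induce U).dist ⟨a, ha⟩ (w.getVert i) = i := by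
    intro i hi
    have h1 := dist_le (w.take i)
    have h2 := dist_le (w.drop i)
    -- On a geodesic the triangle inequality pins the distance of the i-th vertex from a to i;
    -- injectivity and the absence of chords follow.
    have h3 := (w.take i).reachable.dist_triangle_left ⟨b, hb⟩
    rw [Walk.take_length] at h1
    rw [Walk.drop_length] at h2
    omega
  refine ⟨w.length, fun i => w.getVert i, ⟨fun i j hi hj hij => ?_, fun i j hi hj => ⟨fun hadj => ?_,
    ?_⟩⟩, by simp, by simp, fun i => (w.getVert i).2⟩
  · rw [← hd i hi, ← hd j hj, Subtype.ext hij]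
  · have hadj' : (G.induce U).Adj (w.getVert i) (w.getVert j) := hadj
    have h1 := hd i hi
    have h2 := hd j hj
    have hne : i ≠ j := by
      rintro rfl
      exact G.irrefl hadj
    have := hadj'.diff_dist_adj (u := ⟨a, ha⟩)
    omega
  · rintro (rfl | rfl)
    · exact w.adj_getVert_succ (by omega)
    · exact (w.adj_getVert_succ (by omega)).symm

/-- Two induced paths with common ends and no other contact form an induced cycle. -/
theorem exists_cycle_embedding {m l : ℕ} {p q : ℕ → V} (hp : IsInducedPath G m p)
    (hq : IsInducedPath G l q) (hm : 2 ≤ m) (hl : 2 ≤ l) (h0 : p 0 = q 0) (h1 : p m = q l)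
    (hne : ∀ i j, 0 < i → i < m → 0 < j → j < l → p i ≠ q j ∧ ¬ G.Adj (p i) (q j)) :
    Nonempty (cycleGraph (m + l) ↪g G) := by
  -- Go out along p and return along q reversed, stopping at q 1, the neighbour of the starting
  -- point.
  let c : ℕ → V := fun i => if i ≤ m then p i else q (m + l - i)
  have key : ∀ i j, i < m + l → j < m + l → i < j → c i ≠ c j ∧
      (G.Adj (c i) (c j) ↔ i + 1 = j ∨ (i = 0 ∧ j + 1 = m + l)) := by
    intro i j hi hj hij
    by_cases hjm : j ≤ m
    · have him : i ≤ m := by omega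
      simp only [c, if_pos hjm, if_pos him]
      refine ⟨fun h => ?_, ?_⟩
      · have := hp.inj i j him hjm h
        omega
      · rw [hp.adj_iff i j him hjm]
        omega
    · by_cases him : i ≤ m
      · simp only [c, if_neg hjm, if_pos him]
        rcases Nat.eq_zero_or_pos i with rfl | hi0
        · rw [h0, hq.adj_iff 0 _ (by omega) (by omega)]
          refine ⟨fun h => ?_, by omega⟩
          have := hq.inj 0 _ (by omega) (by omega) h
          omega
        · rcases him.lt_or_eq with him' | rfl
          · obtain ⟨h2, h3⟩ := hne i (m + l - j) hi0 him' (by omega) (by omega)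
            refine ⟨h2, ⟨fun h => absurd h h3, by omega⟩⟩
          · rw [h1, hq.adj_iff l _ (by omega) (by omega)]
            refine ⟨fun h => ?_, by omega⟩
            have := hq.inj l _ (by omega) (by omega) h
            omega
      · simp only [c, if_neg hjm, if_neg him]
        rw [hq.adj_iff _ _ (by omega) (by omega)]
        refine ⟨fun h => ?_, by omega⟩
        have := hq.inj _ _ (by omega) (by omega) h
        omega
  refine ⟨⟨⟨fun x => c x, fun x y hxy => ?_⟩, fun {x y} => ?_⟩⟩
  · have hx := x.isLt
    have hy := y.isLt
    rcases Nat.lt_trichotomy x.val y.val with h | h | h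
    · exact absurd hxy (key x y hx hy h).1
    · exact Fin.ext h
    · exact absurd hxy.symm (key y x hy hx h).1
  · have hx := x.isLt
    have hy := y.isLt
    change G.Adj (c x) (c y) ↔ _
    rw [cycleGraph_adj_iff (by omega)]
    rcases Nat.lt_trichotomy x.val y.val with h | h | h
    · rw [(key x y hx hy h).2]
      omega
    · rw [h]
      refine ⟨fun h' => absurd h' G.irrefl, by omega⟩
    · rw [G.adj_comm, (key y x hy hx h).2]
      omega

/-- The vertices of a component of the complement of `S`. -/
def side {S : Set V} (C : (G.induce Sᶜ).ConnectedComponent) : Set V := Subtype.val '' C.supp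

/-- By minimality S without a does not separate, so a walk from C reaches a while avoiding the rest
of S. The edge by which it leaves C must end at a, since otherwise its end would still lie in C. -/
theorem exists_adj_side {S : Set V} (hS : IsVertexCut G S) {a : V} (ha : a ∈ S)
    (C : (G.induce Sᶜ).ConnectedComponent) : ∃ x ∈ side C, G.Adj x a := by
  have hpre := preconnected_of_not_separates
    (hS.2.2 (S \ {a}) ⟨Set.sdiff_subset, fun h => (h ha).2 rfl⟩)
  obtain ⟨x, hx⟩ := C.nonempty_supp
  have hxm : x.1 ∈ (S \ {a})ᶜ := fun h => x.2 h.1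
  have ham : a ∈ (S \ {a})ᶜ := fun h => h.2 rfl
  obtain ⟨w⟩ := hpre ⟨x.1, hxm⟩ ⟨a, ham⟩
  obtain ⟨d, -, hd1, hd2⟩ := w.exists_boundary_dart {y | y.1 ∈ side C} ⟨x, hx, rfl⟩ (by
    rintro ⟨y, -, hy⟩
    have hya : y.1 = a := hy
    exact y.2 (hya ▸ ha))
  have hadj : G.Adj d.fst.1 d.snd.1 := d.adj
  by_cases hda : d.snd.1 = a
  · exact ⟨d.fst.1, hd1, by rwa [hda] at hadj⟩
  · exfalso
    apply hd2
    obtain ⟨y, hy, hyd⟩ := hd1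
    have hdS : d.snd.1 ∈ Sᶜ := fun h => d.snd.2 ⟨h, hda⟩
    refine ⟨⟨d.snd.1, hdS⟩, C.mem_supp_of_adj_mem_supp hy ?_, rfl⟩
    change G.Adj y.1 d.snd.1
    rw [hyd]
    exact hadj

/-- Take a shortest path inside C together with a and b. It meets a and b only at its ends, and
non-adjacency gives length at least 2. -/
theorem exists_isInducedPath_side {S : Set V} (hS : IsVertexCut G S) {a b : V} (ha : a ∈ S)
    (hb : b ∈ S) (hab : a ≠ b) (hadj : ¬ G.Adj a b) (C : (G.induce Sᶜ).ConnectedComponent) :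
    ∃ n p, IsInducedPath G n p ∧ p 0 = a ∧ p n = b ∧ 2 ≤ n ∧
      ∀ i, 0 < i → i < n → p i ∈ side C := by
  obtain ⟨x, ⟨x', hx', rfl⟩, hxa⟩ := exists_adj_side hS ha C
  obtain ⟨y, ⟨y', hy', rfl⟩, hyb⟩ := exists_adj_side hS hb C
  have hreach : (G.induce (side C ∪ {a, b})).Reachable ⟨a, by simp⟩ ⟨b, by simp⟩ := by
    have h1 : C.toSimpleGraph.Reachable ⟨x', hx'⟩ ⟨y', hy'⟩ :=
      C.connected_toSimpleGraph.preconnected _ _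
    let g : C.toSimpleGraph →g G.induce (side C ∪ {a, b}) :=
      ⟨fun z => ⟨z.1.1, Or.inl ⟨z.1, z.2, rfl⟩⟩, fun h => h⟩
    refine Reachable.trans (Adj.reachable ?_) ((h1.map g).trans (Adj.reachable ?_))
    · exact hxa.symm
    · exact hyb
  obtain ⟨n, p, hp, hp0, hpn, hpU⟩ := exists_isInducedPath _ _ hreach
  refine ⟨n, p, hp, hp0, hpn, ?_, fun i hi hin => ?_⟩
  · by_contra hn
    rcases (by omega : n = 0 ∨ n = 1) with rfl | rfl
    · exact hab (hp0.symm.trans hpn)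
    · apply hadj
      rw [← hp0, ← hpn, hp.adj_iff 0 1 (by omega) (by omega)]
      omega
  · rcases hpU i with h | h | h
    · exact h
    · have := hp.inj i 0 (by omega) (by omega) (h.trans hp0.symm)
      omega
    · have := hp.inj i n (by omega) (by omega) (h.trans hpn.symm)
      omega

/-- Different components of the complement share no vertex and no edge, so the paths through two of
them meet only at a and b. -/
theorem exists_cycle_of_isVertexCut {S : Set V} (hS : IsVertexCut G S) (hcl : ¬ G.IsClique S) :
    ∃ k, 4 ≤ k ∧ Nonempty (cycleGraph k ↪g G) := by
  obtain ⟨a, ha, b, hb, hab, hadj⟩ : ∃ a ∈ S, ∃ b ∈ S, a ≠ b ∧ ¬ G.Adj a b := by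
    by_contra! h
    exact hcl fun a ha b hb hab => h a ha b hb hab
  obtain ⟨C, D, hCD⟩ := hS.2.1
  obtain ⟨m, p, hp, hp0, hpm, hm, hpC⟩ := exists_isInducedPath_side hS ha hb hab hadj C
  obtain ⟨l, q, hq, hq0, hql, hl, hqD⟩ := exists_isInducedPath_side hS ha hb hab hadj D
  refine ⟨m + l, by omega, exists_cycle_embedding hp hq hm hl (hp0.trans hq0.symm)
    (hpm.trans hql.symm) fun i j hi him hj hjl => ?_⟩
  obtain ⟨x, hx, hxp⟩ := hpC i hi him
  obtain ⟨y, hy, hyq⟩ := hqD j hj hjl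
  rw [← hxp, ← hyq]
  refine ⟨fun h => hCD ?_, fun h => hCD ?_⟩
  · exact ConnectedComponent.eq_of_common_vertex hx (Subtype.ext h ▸ hy)
  · have h' : (G.induce Sᶜ).Adj x y := h
    exact ConnectedComponent.eq_of_common_vertex (C.mem_supp_of_adj_mem_supp hx h') hy

theorem exists_cycle_of_two_le_CC (h : 2 ≤ CC G) : ∃ k, 4 ≤ k ∧ Nonempty (cycleGraph k ↪g G) := by
  obtain ⟨E, hE⟩ := exists_component_of_two_le_CC h
  obtain ⟨S, hS, hcl⟩ := exists_isVertexCut_of_two_le_connectedCC hE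
  obtain ⟨k, hk, ⟨f⟩⟩ := exists_cycle_of_isVertexCut hS hcl
  exact ⟨k, hk, ⟨f.trans (Embedding.induce E.supp)⟩⟩

/-- A full subgraph with `CC ≥ 2` contains an induced cycle of length at least 4. -/
theorem exists_induce_iso_cycleGraph {X : Set V} (h : 2 ≤ CC (G.induce X)) :
    ∃ Y ⊆ X, ∃ k, 4 ≤ k ∧ Nonempty (G.induce Y ≃g cycleGraph k) := by
  obtain ⟨k, hk, ⟨f⟩⟩ := exists_cycle_of_two_le_CC h
  let g : cycleGraph k ↪g G := f.trans (Embedding.induce X)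
  refine ⟨Set.range g, ?_, k, hk, ⟨(RelIso.symm ⟨Equiv.ofInjective g g.injective, ?_⟩)⟩⟩
  · rintro _ ⟨i, rfl⟩
    exact (f i).2
  · intro i j
    exact g.map_adj_iff

theorem exists_two_le_CC_of_two_le_dimCC (h : 2 ≤ dimCC G) : ∃ X : Set V, 2 ≤ CC (G.induce X) := by
  by_contra! hX
  have h1 : dimCC G ≤ 1 := iSup_le fun X =>
    ENat.lt_add_one_iff (by simp) |>.1 (by rw [one_add_one_eq_two]; exact hX X)
  exact absurd (h.trans h1) (by decide)

theorem isOneEnded_of_cycle {k : ℕ} (hk : 4 ≤ k) (φ : G ≃g cycleGraph k) {H : Type v} [Group H]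
    (e : W G ≃* H) : IsOneEnded H := by
  have : Finite V := Finite.of_equiv _ φ.symm.toEquiv
  have : Fintype V := Fintype.ofFinite V
  refine isOneEnded_of_not_separates G (fun h => ?_) (fun D hD => cycle_not_separates hk φ hD) e
  obtain ⟨S, hS⟩ := exists_isVertexCut_of_cycle hk φ
  -- If the cycle were complete, its vertex cut would be a separating clique.
  exact cycle_not_separates hk φ (h.subset (Set.subset_univ S)) hS.2.1

end InducedCycles

end RACG

/-! ### The three statements, from induced cycles -/

theorem mainTheorem8 {V : Type*} (Γ : SimpleGraph V) :
    -- a one-ended parabolic subgroup exists as soon as the clique-connected dimension is at least 2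
    (2 ≤ RACG.dimCC Γ → ∃ X : Set V, RACG.IsOneEnded (RACG.parabolic Γ X)) ∧
    -- a minimal full subgraph with `CC ≥ 2` is a `k`-cycle for some `k ≥ 4`
    (∀ X : Set V, 2 ≤ RACG.CC (Γ.induce X) →
      (∀ Y : Set V, Y ⊂ X → ¬ 2 ≤ RACG.CC (Γ.induce Y)) →
      ∃ k : ℕ, 4 ≤ k ∧ Nonempty (Γ.induce X ≃g SimpleGraph.cycleGraph k)) ∧
    -- the right-angled Coxeter group of an induced `k`-cycle with `k ≥ 4`, and the parabolic
    -- subgroup that the cycle defines, are one-ended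
    (∀ (X : Set V) (k : ℕ), 4 ≤ k → Nonempty (Γ.induce X ≃g SimpleGraph.cycleGraph k) →
      RACG.IsOneEnded (RACG.W (Γ.induce X)) ∧ RACG.IsOneEnded (RACG.parabolic Γ X)) := by
  refine ⟨fun h => ?_, fun X hX hmin => ?_, ?_⟩
  · obtain ⟨X, hX⟩ := RACG.exists_two_le_CC_of_two_le_dimCC h
    obtain ⟨Y, -, k, hk, ⟨φ⟩⟩ := RACG.exists_induce_iso_cycleGraph hX
    exact ⟨Y, RACG.isOneEnded_of_cycle hk φ (RACG.parabolicEquiv Γ Y)⟩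
  · obtain ⟨Y, hYX, k, hk, ⟨φ⟩⟩ := RACG.exists_induce_iso_cycleGraph hX
    -- The cycle on Y itself has `CC ≥ 2`, so minimality leaves only Y = X.
    rcases hYX.eq_or_ssubset with rfl | hss
    · exact ⟨k, hk, ⟨φ⟩⟩
    · exact absurd (RACG.two_le_CC_of_cycle hk φ) (hmin Y hss)
  · rintro X k hk ⟨φ⟩
    exact ⟨RACG.isOneEnded_of_cycle hk φ (MulEquiv.refl _),
      RACG.isOneEnded_of_cycle hk φ (RACG.parabolicEquiv Γ X)⟩
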